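/- Let $G=(V,E,w)$ be a finite connected simple undirected graph with $n=|V|\ge 1$ vertices, $m=|E|$ edges and positive edge weights $w:E\to(0,\infty)$. For a spanning tree $T$ of $G$ and an edge $e\in E$, let $p_T(e)$ be the set of edges on the unique path in $T$ between the endpoints of $e$, and define the stretch $$\mathrm{St}_T(e)=\sum_{e'\in p_T(e)}\frac{w(e)}{w(e')},\qquad \mathrm{St}_T(G)=\sum_{e\in E}\mathrm{St}_T(e).$$ Let $\mathcal T$ be a random spanning tree of $G$, where each spanning tree $T$ is chosen with probability proportional to $\prod_{e\in T}w(e)$. Then $$\mathbb E\left[\mathrm{St}_{\mathcal T}(G)\right]\le (n-1)(m-n+2),$$ and if not every set of $n-1$ edges of $G$ is the edge set of a spanning tree (equivalently, if $G$ is neither a tree nor a cycle), then the inequality is strict: $$\mathbb E\left[\mathrm{St}_{\mathcal T}(G)\right]<(n-1)(m-n+2).$$ -/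

import Mathlib

/-- The graph `(V, F)` is a spanning tree of `G`: `F` is a set of edges of `G` and the graph on the
whole vertex set `V` with edge set `F` is a tree. -/
def IsSpanningTree {V : Type*} [Fintype V] [DecidableEq V] (G : SimpleGraph V)
    [DecidableRel G.Adj] (F : Finset (Sym2 V)) : Prop :=
  F ⊆ G.edgeFinset ∧ (SimpleGraph.fromEdgeSet (F : Set (Sym2 V))).IsTree

open Classical in
/-- The finite set of all spanning trees of `G`, each given by its edge set. -/
noncomputable def spanningTrees {V : Type*} [Fintype V] [DecidableEq V] (G : SimpleGraph V)
    [DecidableRel G.Adj] : Finset (Finset (Sym2 V)) :=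
  G.edgeFinset.powerset.filter (fun F => IsSpanningTree G F)

open Classical in
/-- The edges on the paths in `(V, F)` between the two endpoints of `e`. If `(V, F)` is a tree,
there is exactly one such path (up to its direction). -/
noncomputable def treePathEdges {V : Type*} (F : Finset (Sym2 V)) (e : Sym2 V) :
    Finset (Sym2 V) :=
  F.filter (fun e' => ∃ (u v : V) (p : (SimpleGraph.fromEdgeSet (F : Set (Sym2 V))).Walk u v),
    s(u, v) = e ∧ p.IsPath ∧ e' ∈ p.edges)

/-- The stretch of the edge `e` with respect to the tree with edge set `F`. -/
noncomputable def edgeStretch {V : Type*} (w : Sym2 V → ℝ) (F : Finset (Sym2 V)) (e : Sym2 V) :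
    ℝ :=
  ∑ e' ∈ treePathEdges F e, w e / w e'

/-- The stretch of the graph `G` with respect to the tree with edge set `F`. -/
noncomputable def graphStretch {V : Type*} [Fintype V] [DecidableEq V] (G : SimpleGraph V)
    [DecidableRel G.Adj] (w : Sym2 V → ℝ) (F : Finset (Sym2 V)) : ℝ :=
  ∑ e ∈ G.edgeFinset, edgeStretch w F e

/-- The probability of the spanning tree `F` when spanning trees of `G` are sampled with
probability proportional to the product of the edge weights. -/
noncomputable def treeProb {V : Type*} [Fintype V] [DecidableEq V] (G : SimpleGraph V)
    [DecidableRel G.Adj] (w : Sym2 V → ℝ) (F : Finset (Sym2 V)) : ℝ :=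
  (∏ e ∈ F, w e) / ∑ F' ∈ spanningTrees G, ∏ e ∈ F', w e

/-- The expected stretch of `G` with respect to a random spanning tree distributed according to
`treeProb`. -/
noncomputable def expectedStretch {V : Type*} [Fintype V] [DecidableEq V] (G : SimpleGraph V)
    [DecidableRel G.Adj] (w : Sym2 V → ℝ) : ℝ :=
  ∑ F ∈ spanningTrees G, treeProb G w F * graphStretch G w F

/-!
For a spanning tree `F`, an edge `e` of `G` outside `F` and an edge `f` of `F`, the edge `f` lies on
the tree path between the endpoints of `e` if and only if `F - f + e` is again a spanning tree. Its
contribution `w e / w f` to the stretch is then the ratio of the weights of the trees `F - f + e`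
and `F`. As exchanges are reversible, summing these contributions against the weights of the trees
`F` is the same as counting the exchanges at `F`, so that `𝔼 St(G)` is `n - 1`, the part of the tree
edges, plus the expected number of exchanges at the random tree. Each tree has at most
`(n - 1) * (m - (n - 1))` exchanges. If every tree attained this number, then exchanges would lead
from a spanning tree to every set of `n - 1` edges.
-/

open Finset

section ExchangePairs

variable {α : Type*} [DecidableEq α] {𝓑 : Finset (Finset α)} {E B : Finset α}

/-- The pairs `(e, f)` with `e ∈ B` and `f ∈ E \ B` such that exchanging `e` for `f` leads from `B`
to a member of `𝓑`: the edges at `B` of the exchange graph of the family `𝓑`. -/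
def exchangePairs (𝓑 : Finset (Finset α)) (E B : Finset α) : Finset (α × α) :=
  {p ∈ B ×ˢ (E \ B) | insert p.2 (B.erase p.1) ∈ 𝓑}

theorem mem_exchangePairs {p : α × α} :
    p ∈ exchangePairs 𝓑 E B ↔
      (p.1 ∈ B ∧ p.2 ∈ E ∧ p.2 ∉ B) ∧ insert p.2 (B.erase p.1) ∈ 𝓑 := by
  simp only [exchangePairs, mem_filter, mem_product, mem_sdiff]

theorem insert_erase_insert_erase {e f : α} (he : e ∈ B) (hf : f ∉ B) :
    insert e ((insert f (B.erase e)).erase f) = B := by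
  rw [erase_insert (fun h => hf (mem_of_mem_erase h)), insert_erase he]

theorem prod_insert_erase {K : Type*} [Semifield K] {w : α → K} {e f : α} (he : e ∈ B) (hf : f ∉ B)
    (hwe : w e ≠ 0) : ∏ g ∈ insert f (B.erase e), w g = (∏ g ∈ B, w g) * (w f / w e) := by
  rw [prod_insert (fun h => hf (mem_of_mem_erase h)), ← mul_prod_erase B w he]
  field_simp

theorem swap_mem_exchangePairs (hBE : B ⊆ E) (hB : B ∈ 𝓑) {p : α × α}
    (hp : p ∈ exchangePairs 𝓑 E B) :
    p.swap ∈ exchangePairs 𝓑 E (insert p.2 (B.erase p.1)) := by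
  obtain ⟨⟨he, -, hf⟩, -⟩ := mem_exchangePairs.1 hp
  have hne : p.1 ≠ p.2 := ne_of_mem_of_not_mem he hf
  refine mem_exchangePairs.2 ⟨⟨mem_insert_self _ _, hBE he, by simp [hne]⟩, ?_⟩
  rwa [Prod.fst_swap, Prod.snd_swap, insert_erase_insert_erase he hf]

theorem sum_prod_mul_sum_exchangePairs {K : Type*} [Semifield K] {w : α → K}
    (h𝓑 : ∀ B ∈ 𝓑, B ⊆ E) (hw : ∀ e ∈ E, w e ≠ 0) :
    ∑ B ∈ 𝓑, (∏ e ∈ B, w e) * ∑ p ∈ exchangePairs 𝓑 E B, w p.2 / w p.1 =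
      ∑ B ∈ 𝓑, (∏ e ∈ B, w e) * #(exchangePairs 𝓑 E B) := by
  let exchange (x : Σ _ : Finset α, α × α) : Σ _ : Finset α, α × α :=
    ⟨insert x.2.2 (x.1.erase x.2.1), x.2.swap⟩
  have exchange_mem : ∀ x ∈ 𝓑.sigma (exchangePairs 𝓑 E),
      exchange x ∈ 𝓑.sigma (exchangePairs 𝓑 E) := by
    intro x hx
    obtain ⟨hB, hp⟩ := mem_sigma.1 hx
    exact mem_sigma.2 ⟨(mem_exchangePairs.1 hp).2, swap_mem_exchangePairs (h𝓑 _ hB) hB hp⟩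
  have exchange_exchange : ∀ x ∈ 𝓑.sigma (exchangePairs 𝓑 E), exchange (exchange x) = x := by
    rintro ⟨B, e, f⟩ hx
    obtain ⟨⟨he, -, hf⟩, -⟩ := mem_exchangePairs.1 (mem_sigma.1 hx).2
    exact Sigma.ext (insert_erase_insert_erase he hf) HEq.rfl
  have prod_exchange : ∀ x ∈ 𝓑.sigma (exchangePairs 𝓑 E),
      (∏ g ∈ x.1, w g) * (w x.2.2 / w x.2.1) = ∏ g ∈ (exchange x).1, w g := by
    rintro ⟨B, e, f⟩ hx
    obtain ⟨hB, hp⟩ := mem_sigma.1 hx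
    obtain ⟨⟨he, -, hf⟩, -⟩ := mem_exchangePairs.1 hp
    exact (prod_insert_erase he hf (hw e (h𝓑 B hB he))).symm
  calc ∑ B ∈ 𝓑, (∏ e ∈ B, w e) * ∑ p ∈ exchangePairs 𝓑 E B, w p.2 / w p.1
      = ∑ x ∈ 𝓑.sigma (exchangePairs 𝓑 E), (∏ g ∈ x.1, w g) * (w x.2.2 / w x.2.1) := by
        simp only [mul_sum, sum_sigma]
    _ = ∑ x ∈ 𝓑.sigma (exchangePairs 𝓑 E), ∏ g ∈ x.1, w g :=
        sum_nbij' exchange exchange exchange_mem exchange_mem exchange_exchange exchange_exchange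
          prod_exchange
    _ = ∑ B ∈ 𝓑, (∏ e ∈ B, w e) * #(exchangePairs 𝓑 E B) := by
        simp only [sum_sigma, sum_const, nsmul_eq_mul, mul_comm]

theorem card_exchangePairs_le : #(exchangePairs 𝓑 E B) ≤ #B * #(E \ B) :=
  (card_filter_le _ _).trans_eq (card_product _ _)

theorem exists_card_exchangePairs_lt {H : Finset α} (h𝓑 : 𝓑.Nonempty)
    (hcard : ∀ B ∈ 𝓑, #B = #H) (hHE : H ⊆ E) (hH : H ∉ 𝓑) :
    ∃ B ∈ 𝓑, #(exchangePairs 𝓑 E B) < #B * #(E \ B) := by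
  -- A member of `𝓑` closest to `H` admits an exchange towards `H` that leaves `𝓑`.
  obtain ⟨B, hB, hmin⟩ := exists_min_image 𝓑 (fun B => #(H \ B)) h𝓑
  have hHB : (H \ B).Nonempty := by
    rw [sdiff_nonempty]
    exact fun h => hH (eq_of_subset_of_card_le h (hcard B hB).le ▸ hB)
  have hBH : (B \ H).Nonempty := by
    rwa [← card_pos, card_sdiff_comm (hcard B hB), card_pos]
  obtain ⟨f, hf⟩ := hHB
  obtain ⟨e, he⟩ := hBH
  have hcloser : #(H \ insert f (B.erase e)) < #(H \ B) :=
    card_lt_card ⟨by grind, fun h => by simpa using h hf⟩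
  refine ⟨B, hB, ?_⟩
  rw [← card_product]
  refine card_lt_card (filter_ssubset.2 ⟨(e, f), ?_, fun h => (hmin _ h).not_gt hcloser⟩)
  rw [mem_sdiff] at he hf
  exact mem_product.2 ⟨he.1, mem_sdiff.2 ⟨hHE hf.1, hf.2⟩⟩

end ExchangePairs

section Tree

open SimpleGraph

variable {V : Type*}

theorem eq_of_isPath_of_isAcyclic {G : SimpleGraph V} (hG : G.IsAcyclic) {u v : V}
    {p q : G.Walk u v} (hp : p.IsPath) (hq : q.IsPath) : p = q :=
  congrArg Subtype.val ((hG.subsingleton_path u v).elim ⟨p, hp⟩ ⟨q, hq⟩)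

theorem mem_edges_iff_not_reachable_deleteEdges {T : SimpleGraph V} (hT : T.IsAcyclic) {u v : V}
    {p : T.Walk u v} (hp : p.IsPath) {e : Sym2 V} :
    e ∈ p.edges ↔ ¬ (T.deleteEdges {e}).Reachable u v := by
  classical
  induction e with
  | _ x y =>
    rw [reachable_deleteEdges_iff_exists_walk, not_exists_not]
    refine ⟨fun h q => ?_, fun h => h p⟩
    rw [eq_of_isPath_of_isAcyclic hT hp q.bypass_isPath] at h
    exact q.edges_bypass_subset_edges h

theorem connected_deleteEdges_sup_edge {G : SimpleGraph V} (hG : G.Connected) {u v : V}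
    (huv : u ≠ v) (hadj : ¬ G.Adj u v) {p : G.Walk u v} (hp : p.IsPath) {e : Sym2 V}
    (he : e ∈ p.edges) : (G.deleteEdges {e} ⊔ edge u v).Connected := by
  have hadj_sup : (G ⊔ edge u v).Adj v u := Or.inr ((edge_adj ..).2 ⟨by simp, huv.symm⟩)
  have hnot_mem : s(u, v) ∉ p.edges := fun h => hadj (p.adj_of_mem_edges h)
  have hcycle : (Walk.cons hadj_sup (p.mapLe le_sup_left)).IsCycle := by
    rw [Walk.cons_isCycle_iff, Walk.isPath_mapLe, Walk.edges_mapLe_eq_edges, Sym2.eq_swap]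
    exact ⟨hp, hnot_mem⟩
  have hnot_bridge : ¬ (G ⊔ edge u v).IsBridge e := fun h =>
    h.notMem_edges_of_isCycle hcycle (by simp [he])
  have hdelete : (G ⊔ edge u v).deleteEdges {e} = G.deleteEdges {e} ⊔ edge u v := by
    have hne : e ≠ s(u, v) := ne_of_mem_of_not_mem he hnot_mem
    have hdisjoint : Disjoint (edge u v).edgeSet {e} := by simp [edge, hne]
    rw [deleteEdges_sup, deleteEdges_eq_self.2 hdisjoint]
  rw [← hdelete]
  induction e with
  | _ x y => exact (hG.mono le_sup_left).connected_delete_edge_of_not_isBridge hnot_bridge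

theorem isTree_deleteEdges_sup_edge_iff {T : SimpleGraph V} (hT : T.IsTree) {u v : V}
    (huv : u ≠ v) (hadj : ¬ T.Adj u v) {p : T.Walk u v} (hp : p.IsPath) {e : Sym2 V} :
    (T.deleteEdges {e} ⊔ edge u v).IsTree ↔ e ∈ p.edges := by
  refine ⟨fun h => ?_, fun h => ⟨connected_deleteEdges_sup_edge hT.connected huv hadj hp h, ?_⟩⟩
  · rw [mem_edges_iff_not_reachable_deleteEdges hT.isAcyclic hp]
    intro hreach
    rcases (isAcyclic_sup_fromEdgeSet_iff.1 h.isAcyclic).2 hreach with h | h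
    · exact huv h
    · exact hadj (deleteEdges_le _ h)
  · exact (hT.isAcyclic.anti (deleteEdges_le _)).sup_edge_of_not_reachable
      ((mem_edges_iff_not_reachable_deleteEdges hT.isAcyclic hp).1 h)

theorem treePathEdges_subset (F : Finset (Sym2 V)) (e : Sym2 V) : treePathEdges F e ⊆ F := by
  classical
  exact filter_subset _ _

theorem mem_treePathEdges_iff_mem_edges {F : Finset (Sym2 V)}
    (hF : (fromEdgeSet (F : Set (Sym2 V))).IsAcyclic) {u v : V}
    {p : (fromEdgeSet (F : Set (Sym2 V))).Walk u v} (hp : p.IsPath) {f : Sym2 V} :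
    f ∈ treePathEdges F s(u, v) ↔ f ∈ p.edges := by
  classical
  simp only [treePathEdges, mem_filter]
  constructor
  · rintro ⟨-, x, y, q, hxy, hq, hf⟩
    rcases Sym2.eq_iff.1 hxy with ⟨rfl, rfl⟩ | ⟨rfl, rfl⟩
    · rwa [eq_of_isPath_of_isAcyclic hF hp hq]
    · rwa [eq_of_isPath_of_isAcyclic hF hp hq.reverse,
        Walk.edges_reverse, List.mem_reverse]
  · intro hf
    have hmem := p.edges_subset_edgeSet hf
    rw [edgeSet_fromEdgeSet] at hmem
    exact ⟨hmem.1, u, v, p, rfl, hp, hf⟩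

theorem treePathEdges_of_mem {F : Finset (Sym2 V)}
    (hF : (fromEdgeSet (F : Set (Sym2 V))).IsAcyclic) {e : Sym2 V} (he : e ∈ F)
    (hdiag : ¬ e.IsDiag) : treePathEdges F e = {e} := by
  induction e with
  | _ u v =>
    have hadj : (fromEdgeSet (F : Set (Sym2 V))).Adj u v := ⟨he, hdiag⟩
    ext f
    simp [mem_treePathEdges_iff_mem_edges hF (Path.singleton hadj).isPath]

theorem mem_treePathEdges_iff_isTree_exchange [DecidableEq V] {F : Finset (Sym2 V)}
    (hF : (fromEdgeSet (F : Set (Sym2 V))).IsTree) {e f : Sym2 V} (he : e ∉ F)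
    (hdiag : ¬ e.IsDiag) :
    f ∈ treePathEdges F e ↔
      (fromEdgeSet (insert e (F.erase f) : Finset (Sym2 V)) : SimpleGraph V).IsTree := by
  induction e with
  | _ u v =>
    obtain ⟨p, hp⟩ := hF.connected.exists_isPath u v
    have hadj : ¬ (fromEdgeSet (F : Set (Sym2 V))).Adj u v := fun h => he h.1
    have hexchange : (fromEdgeSet (insert s(u, v) (F.erase f) : Finset (Sym2 V)) : SimpleGraph V) =
        (fromEdgeSet (F : Set (Sym2 V))).deleteEdges {f} ⊔ edge u v := by
      rw [coe_insert, coe_erase, Set.insert_eq, fromEdgeSet_union, fromEdgeSet_sdiff, sup_comm]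
      rfl
    rw [mem_treePathEdges_iff_mem_edges hF.isAcyclic hp, hexchange,
      isTree_deleteEdges_sup_edge_iff hF hdiag hadj hp]

end Tree

section SpanningTree

variable {V : Type*} [Fintype V] [DecidableEq V] {G : SimpleGraph V} [DecidableRel G.Adj]
  {F : Finset (Sym2 V)} {w : Sym2 V → ℝ}

theorem mem_spanningTrees : F ∈ spanningTrees G ↔ IsSpanningTree G F := by
  simp only [spanningTrees, mem_filter, mem_powerset, and_iff_right_iff_imp]
  exact fun h => h.1

theorem subset_of_mem_spanningTrees (hF : F ∈ spanningTrees G) : F ⊆ G.edgeFinset :=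
  (mem_spanningTrees.1 hF).1

theorem spanningTrees_nonempty (hG : G.Connected) : (spanningTrees G).Nonempty := by
  classical
  obtain ⟨T, hTG, hT⟩ := hG.exists_isTree_le
  refine ⟨T.edgeFinset, mem_spanningTrees.2 ⟨SimpleGraph.edgeFinset_mono hTG, ?_⟩⟩
  rwa [SimpleGraph.coe_edgeFinset, SimpleGraph.fromEdgeSet_edgeSet]

theorem card_add_one_of_mem_spanningTrees (hF : F ∈ spanningTrees G) :
    #F + 1 = Fintype.card V := by
  classical
  have hFG := subset_of_mem_spanningTrees hF
  have hedges : (SimpleGraph.fromEdgeSet (F : Set (Sym2 V))).edgeFinset = F := by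
    ext e
    simpa using fun he => G.not_isDiag_of_mem_edgeFinset (hFG he)
  rw [← (mem_spanningTrees.1 hF).2.card_edgeFinset, hedges]

theorem treePathEdges_of_notMem (hF : F ∈ spanningTrees G) {e : Sym2 V}
    (he : e ∈ G.edgeFinset \ F) :
    treePathEdges F e = {f ∈ F | insert e (F.erase f) ∈ spanningTrees G} := by
  obtain ⟨heG, heF⟩ := mem_sdiff.1 he
  obtain ⟨hFG, htree⟩ := mem_spanningTrees.1 hF
  ext f
  have hexchange : f ∈ treePathEdges F e ↔ insert e (F.erase f) ∈ spanningTrees G := by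
    rw [mem_spanningTrees, mem_treePathEdges_iff_isTree_exchange htree heF
      (G.not_isDiag_of_mem_edgeFinset heG), IsSpanningTree,
      and_iff_right (insert_subset heG ((erase_subset _ _).trans hFG))]
  rw [mem_filter, ← hexchange, iff_and_self]
  exact fun hf => treePathEdges_subset F e hf

theorem edgeStretch_of_mem (hF : F ∈ spanningTrees G) {e : Sym2 V} (he : e ∈ F) (hwe : w e ≠ 0) :
    edgeStretch w F e = 1 := by
  obtain ⟨hFG, htree⟩ := mem_spanningTrees.1 hF
  have hdiag : ¬ e.IsDiag := G.not_isDiag_of_mem_edgeFinset (hFG he)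
  rw [edgeStretch, treePathEdges_of_mem htree.isAcyclic he hdiag, sum_singleton, div_self hwe]

theorem graphStretch_eq_add_sum_exchangePairs (hF : F ∈ spanningTrees G)
    (hw : ∀ e ∈ F, w e ≠ 0) :
    graphStretch G w F = (Fintype.card V - 1) +
      ∑ p ∈ exchangePairs (spanningTrees G) G.edgeFinset F, w p.2 / w p.1 := by
  have htree : ∑ e ∈ F, edgeStretch w F e = Fintype.card V - 1 := by
    rw [sum_congr rfl fun e he => edgeStretch_of_mem hF he (hw e he), sum_const, nsmul_one,
      ← card_add_one_of_mem_spanningTrees hF, Nat.cast_add_one, add_sub_cancel_right]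
  have hnontree : ∑ e ∈ G.edgeFinset \ F, edgeStretch w F e =
      ∑ p ∈ exchangePairs (spanningTrees G) G.edgeFinset F, w p.2 / w p.1 := by
    rw [exchangePairs, sum_filter, sum_product_right]
    refine sum_congr rfl fun e he => ?_
    rw [edgeStretch, treePathEdges_of_notMem hF he, sum_filter]
  rw [graphStretch, ← sum_sdiff (subset_of_mem_spanningTrees hF), htree, hnontree, add_comm]

theorem prod_pos_of_mem_spanningTrees (hw : ∀ e ∈ G.edgeSet, 0 < w e)
    (hF : F ∈ spanningTrees G) : 0 < ∏ e ∈ F, w e :=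
  prod_pos fun e he => hw e (SimpleGraph.mem_edgeFinset.1 (subset_of_mem_spanningTrees hF he))

theorem sum_prod_spanningTrees_pos (hG : G.Connected) (hw : ∀ e ∈ G.edgeSet, 0 < w e) :
    0 < ∑ F ∈ spanningTrees G, ∏ e ∈ F, w e :=
  sum_pos (fun _ => prod_pos_of_mem_spanningTrees hw) (spanningTrees_nonempty hG)

theorem treeProb_pos (hG : G.Connected) (hw : ∀ e ∈ G.edgeSet, 0 < w e)
    (hF : F ∈ spanningTrees G) : 0 < treeProb G w F :=
  div_pos (prod_pos_of_mem_spanningTrees hw hF) (sum_prod_spanningTrees_pos hG hw)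

theorem sum_treeProb (hZ : ∑ F ∈ spanningTrees G, ∏ e ∈ F, w e ≠ 0) :
    ∑ F ∈ spanningTrees G, treeProb G w F = 1 := by
  simp only [treeProb]
  rw [← sum_div, div_self hZ]

theorem expectedStretch_eq_add_sum_card_exchangePairs (hw : ∀ e ∈ G.edgeFinset, w e ≠ 0)
    (hZ : ∑ F ∈ spanningTrees G, ∏ e ∈ F, w e ≠ 0) :
    expectedStretch G w = (Fintype.card V - 1) + ∑ F ∈ spanningTrees G,
      treeProb G w F * #(exchangePairs (spanningTrees G) G.edgeFinset F) := by
  have hreverse : ∑ F ∈ spanningTrees G, treeProb G w F *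
        ∑ p ∈ exchangePairs (spanningTrees G) G.edgeFinset F, w p.2 / w p.1 =
      ∑ F ∈ spanningTrees G,
        treeProb G w F * #(exchangePairs (spanningTrees G) G.edgeFinset F) := by
    simp only [treeProb, div_mul_eq_mul_div]
    rw [← sum_div, ← sum_div,
      sum_prod_mul_sum_exchangePairs (fun _ => subset_of_mem_spanningTrees) hw]
  calc expectedStretch G w
      = ∑ F ∈ spanningTrees G, treeProb G w F * ((Fintype.card V - 1) +
          ∑ p ∈ exchangePairs (spanningTrees G) G.edgeFinset F, w p.2 / w p.1) :=
        sum_congr rfl fun F hF => by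
          rw [graphStretch_eq_add_sum_exchangePairs hF
            fun e he => hw e (subset_of_mem_spanningTrees hF he)]
    _ = (Fintype.card V - 1) + ∑ F ∈ spanningTrees G,
          treeProb G w F * #(exchangePairs (spanningTrees G) G.edgeFinset F) := by
        simp only [mul_add]
        rw [sum_add_distrib, hreverse, ← sum_mul, sum_treeProb hZ, one_mul]

theorem card_mul_card_sdiff_of_mem_spanningTrees (hF : F ∈ spanningTrees G) :
    ((#F * #(G.edgeFinset \ F) : ℕ) : ℝ) =
      (Fintype.card V - 1) * (#G.edgeFinset - Fintype.card V + 1) := by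
  rw [Nat.cast_mul, cast_card_sdiff (subset_of_mem_spanningTrees hF),
    ← card_add_one_of_mem_spanningTrees hF]
  push_cast
  ring

theorem card_exchangePairs_spanningTrees_le (hF : F ∈ spanningTrees G) :
    (#(exchangePairs (spanningTrees G) G.edgeFinset F) : ℝ) ≤
      (Fintype.card V - 1) * (#G.edgeFinset - Fintype.card V + 1) := by
  rw [← card_mul_card_sdiff_of_mem_spanningTrees hF]
  exact mod_cast card_exchangePairs_le

theorem exists_card_exchangePairs_spanningTrees_lt (hG : G.Connected) {H : Finset (Sym2 V)}
    (hHG : H ⊆ G.edgeFinset) (hcard : #H + 1 = Fintype.card V) (hH : ¬ IsSpanningTree G H) :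
    ∃ F ∈ spanningTrees G, (#(exchangePairs (spanningTrees G) G.edgeFinset F) : ℝ) <
      (Fintype.card V - 1) * (#G.edgeFinset - Fintype.card V + 1) := by
  have hcard_eq : ∀ F ∈ spanningTrees G, #F = #H := fun F hF =>
    Nat.add_right_cancel ((card_add_one_of_mem_spanningTrees hF).trans hcard.symm)
  obtain ⟨F, hF, hlt⟩ := exists_card_exchangePairs_lt (spanningTrees_nonempty hG) hcard_eq hHG
    (mt mem_spanningTrees.1 hH)
  refine ⟨F, hF, ?_⟩
  rw [← card_mul_card_sdiff_of_mem_spanningTrees hF]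
  exact mod_cast hlt

end SpanningTree

theorem mainTheorem10 {V : Type*} [Fintype V] [DecidableEq V] (G : SimpleGraph V)
    [DecidableRel G.Adj] (hG : G.Connected) (w : Sym2 V → ℝ) (hw : ∀ e ∈ G.edgeSet, 0 < w e) :
    expectedStretch G w ≤
        ((Fintype.card V : ℝ) - 1) * ((G.edgeFinset.card : ℝ) - (Fintype.card V : ℝ) + 2) ∧
      ((∃ H : Finset (Sym2 V), H ⊆ G.edgeFinset ∧ H.card + 1 = Fintype.card V ∧
          ¬ IsSpanningTree G H) →
        expectedStretch G w <
          ((Fintype.card V : ℝ) - 1) * ((G.edgeFinset.card : ℝ) - (Fintype.card V : ℝ) + 2)) := by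
  set c : ℝ := (Fintype.card V - 1) * (#G.edgeFinset - Fintype.card V + 1) with hc
  have hZ := (sum_prod_spanningTrees_pos hG hw).ne'
  have hmean : ∑ F ∈ spanningTrees G, treeProb G w F * c = c := by
    rw [← sum_mul, sum_treeProb hZ, one_mul]
  have hle : ∀ F ∈ spanningTrees G,
      treeProb G w F * #(exchangePairs (spanningTrees G) G.edgeFinset F) ≤ treeProb G w F * c :=
    fun F hF => mul_le_mul_of_nonneg_left (card_exchangePairs_spanningTrees_le hF)
      (treeProb_pos hG hw hF).le
  have hbound : ((Fintype.card V : ℝ) - 1) * (#G.edgeFinset - Fintype.card V + 2) =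
      (Fintype.card V - 1) + ∑ F ∈ spanningTrees G, treeProb G w F * c := by
    rw [hmean, hc]
    ring
  rw [hbound, expectedStretch_eq_add_sum_card_exchangePairs
    (fun e he => (hw e (SimpleGraph.mem_edgeFinset.1 he)).ne') hZ]
  refine ⟨add_le_add le_rfl (sum_le_sum hle), fun ⟨H, hHG, hcard, hH⟩ => ?_⟩
  obtain ⟨F, hF, hlt⟩ := exists_card_exchangePairs_spanningTrees_lt hG hHG hcard hH
  exact add_lt_add_of_le_of_lt le_rfl
    (sum_lt_sum hle ⟨F, hF, mul_lt_mul_of_pos_left hlt (treeProb_pos hG hw hF)⟩)
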